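/- Let $G$ and $H$ be finite groups, let $X$ be a finite set on which $H$ acts freely (on the left, all point stabilizers trivial), and let $\Phi\colon X\to \mathrm{Aut}(G)\sqcup\mathrm{Hom}(G,H)$ be a map such that (S1) $\Phi(X)\cap\mathrm{Aut}(G)\neq\emptyset$; (S2) $\Phi(X)\cap\mathrm{Hom}(G,H)\neq\emptyset$; (S3) if $A=\langle\Phi(X)\cap\mathrm{Aut}(G)\rangle\leq \mathrm{Aut}(G)$ and $B=\{\mu\circ\alpha : \mu\in\Phi(X)\cap\mathrm{Hom}(G,H),\ \alpha\in A\}$, then $\bigcap_{\lambda\in B}\ker\lambda=\{1\}$. Let the elements of $G\sqcup H$ act on the set $X^*$ of finite words over $X$, fixing the empty word, by the recursive rules $$g(xw)=x\,\Phi(x)(g)(w)\quad(g\in G),\qquad h(xw)=h(x)\,w\quad(h\in H),$$ for $x\in X$, $w\in X^*$, where $\Phi(x)(g)$ acts as an element of $G$ or of $H$ according to whether $\Phi(x)\in\mathrm{Aut}(G)$ or $\Phi(x)\in\mathrm{Hom}(G,H)$. The multispinal group $\mathfrak G$ is the group of permutations of $X^*$ generated by the actions of all elements of $G$ and $H$.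 It is self-similar: for all $g\in\mathfrak G$ and $x\in X$ there are a unique letter $g(x)\in X$ and a unique section $g|_x\in\mathfrak G$ with $g(xw)=g(x)\,g|_x(w)$ for all $w\in X^*$. Let $K$ be a field. The Nekrashevych algebra $\mathcal N_K(\mathfrak G,X)$ is the unital $*$-algebra over $K$ (with $K$-linear involution) generated by $X\cup\mathfrak G$ subject to the relations: the product of $g,h\in\mathfrak G$ in the algebra is their product in $\mathfrak G$, the identity of $\mathfrak G$ is the identity of the algebra, and $g^*=g^{-1}$ for $g\in\mathfrak G$; $gx=g(x)\,g|_x$ for $g\in\mathfrak G$, $x\in X$; $y^*x=\delta_{x,y}$ for $x,y\in X$; and $\sum_{x\in X}xx^*=1$. For a homomorphism $\lambda\colon G\to H$ let $\widetilde\lambda\colon KG\to KH$ be the induced homomorphism of group algebras. Then: 1. $\mathcal N_K(\mathfrak G,X)$ is simple if and only if $\bigcap_{\lambda\in B}\ker\widetilde\lambda=0$. 2. If the characteristic of $K$ does not divide $|G|$, then $\mathcal N_K(\mathfrak G,X)$ is simple if and only if for each irreducible representation $\rho$ of $G$ over the algebraic closure of $K$ there exists $\lambda\in B$ with $\ker\lambda\leq\ker\rho$.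 3. If the characteristic of $K$ divides $|\ker\lambda|$ for every $\lambda\in\Phi(X)\cap\mathrm{Hom}(G,H)$, then $\mathcal N_K(\mathfrak G,X)$ is not simple. -/

import Mathlib

universe u

namespace Multispinal

/-! ### Self-similar groups and their Nekrashevych algebras -/

/-- A group `𝔊` acting on the set `X^*` of words is self-similar if the action is faithful and
length-preserving and for every `g` and every letter `x` there is an element `h` of `𝔊` (the section
`g|_x`) with `g(xw) = g(x) h(w)` for all words `w`. -/
class SelfSimilarGroup (𝔊 X : Type*) [Group 𝔊] [MulAction 𝔊 (List X)] : Prop where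
  faithful : ∀ g h : 𝔊, (∀ w : List X, g • w = h • w) → g = h
  length_smul : ∀ (g : 𝔊) (w : List X), (g • w).length = w.length
  exists_section : ∀ (g : 𝔊) (x : X), ∃ h : 𝔊, ∀ w : List X, g • (x :: w) = g • [x] ++ h • w

/-- The generators of the Nekrashevych algebra: the letters `x`, their adjoints `x^*`, and the
elements `g` of the group (whose adjoints are `g^* = g⁻¹`). -/
inductive Gen (𝔊 X : Type*) : Type _
  | letter (x : X) : Gen 𝔊 X
  | letterStar (x : X) : Gen 𝔊 X
  | elt (g : 𝔊) : Gen 𝔊 X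

open Gen FreeAlgebra in
/-- The defining relations of the Nekrashevych algebra.  The family of relations is closed under the
linear anti-automorphism exchanging `x` with `x^*` and `g` with `g⁻¹`, so that the quotient is
the `*`-algebra with generators `X ∪ 𝔊` and these relations. In `smul_letter` and its adjoint
`letterStar_smul` the hypothesis says exactly that `y = g(x)` and `h = g|_x`; both are determined
by `g` and `x` when the action is self-similar. -/
inductive NekrashevychRel (K 𝔊 X : Type*) [Field K] [Fintype X] [Group 𝔊] [MulAction 𝔊 (List X)] :
    FreeAlgebra K (Gen 𝔊 X) → FreeAlgebra K (Gen 𝔊 X) → Prop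
  | one : NekrashevychRel K 𝔊 X (ι K (elt 1)) 1
  | mul (g h : 𝔊) : NekrashevychRel K 𝔊 X (ι K (elt g) * ι K (elt h)) (ι K (elt (g * h)))
  | smul_letter (g h : 𝔊) (x y : X) (hs : ∀ w : List X, g • (x :: w) = y :: (h • w)) :
      NekrashevychRel K 𝔊 X (ι K (elt g) * ι K (letter x)) (ι K (letter y) * ι K (elt h))
  | letterStar_smul (g h : 𝔊) (x y : X) (hs : ∀ w : List X, g • (x :: w) = y :: (h • w)) :
      NekrashevychRel K 𝔊 X (ι K (letterStar x) * ι K (elt g⁻¹))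
        (ι K (elt h⁻¹) * ι K (letterStar y))
  | star_mul_self (x : X) : NekrashevychRel K 𝔊 X (ι K (letterStar x) * ι K (letter x)) 1
  | star_mul_of_ne (x y : X) (hxy : x ≠ y) :
      NekrashevychRel K 𝔊 X (ι K (letterStar y) * ι K (letter x)) 0
  | sum_mul_star :
      NekrashevychRel K 𝔊 X (∑ x : X, ι K (letter x) * ι K (letterStar x)) 1

/-- The Nekrashevych algebra of the self-similar group `(𝔊, X)` with coefficients in `K`. -/
abbrev NekrashevychAlgebra (K 𝔊 X : Type*) [Field K] [Fintype X] [Group 𝔊] [MulAction 𝔊 (List X)]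
    [SelfSimilarGroup 𝔊 X] : Type _ :=
  RingQuot (NekrashevychRel K 𝔊 X)

/-! ### Multispinal groups -/

section Data

variable {G H X : Type*} [Group G] [Group H] [MulAction H X] (Φ : X → MulAut G ⊕ (G →* H))

/-- `A`, the subgroup of `Aut(G)` generated by `Φ(X) ∩ Aut(G)`. -/
def autSubgroup : Subgroup (MulAut G) :=
  Subgroup.closure {α | ∃ x, Φ x = Sum.inl α}

/-- `B = (Φ(X) ∩ Hom(G,H)) · A`, where `Aut(G)` acts on `Hom(G,H)` by precomposition. -/
def homSet : Set (G →* H) :=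
  {lam | ∃ x μ, ∃ α ∈ autSubgroup Φ, Φ x = Sum.inr μ ∧ lam = μ.comp (α : G ≃* G).toMonoidHom}

/-- The requirements on `Φ` in the data of a multispinal group. -/
structure IsMultispinal : Prop where
  exists_aut : ∃ x α, Φ x = Sum.inl α
  exists_hom : ∃ x μ, Φ x = Sum.inr μ
  iInf_ker : ⨅ lam ∈ homSet Φ, MonoidHom.ker lam = ⊥

/-- The letter `s(x)` for a state `s ∈ G ⊔ H`. -/
def out : G ⊕ H → X → X
  | .inl _, x => x
  | .inr h, x => h • x

/-- The section `s|_x` of a state `s ∈ G ⊔ H`. (The two identities `1_G` and `1_H` are one and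
the same state of the automaton; they act in the same way, as the identity.) -/
def sec : G ⊕ H → X → G ⊕ H
  | .inl g, x => match Φ x with
    | .inl α => .inl (α g)
    | .inr μ => .inr (μ g)
  | .inr _, _ => .inr 1

/-- The action of a state on words. -/
def act : G ⊕ H → List X → List X
  | _, [] => []
  | s, x :: w => out s x :: act (sec Φ s x) w

theorem act_inr_one (w : List X) : act Φ (.inr 1) w = w := by
  induction w with
  | nil => rfl
  | cons x w ih => simp [act, out, sec, ih]

theorem act_inr_inv (h : H) (w : List X) : act Φ (.inr h⁻¹) (act Φ (.inr h) w) = w := by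
  cases w with
  | nil => rfl
  | cons x w => simp [act, out, sec, act_inr_one]

theorem act_inl_inv (g : G) (w : List X) : act Φ (.inl g⁻¹) (act Φ (.inl g) w) = w := by
  induction w generalizing g with
  | nil => rfl
  | cons x w ih =>
    rcases hx : Φ x with α | μ
    · simp [act, out, sec, hx, ih]
    · simp [act, out, sec, hx, act_inr_inv]

/-- The inverse state. -/
def invState : G ⊕ H → G ⊕ H := Sum.map (·⁻¹) (·⁻¹)

theorem act_invState (s : G ⊕ H) (w : List X) : act Φ (invState s) (act Φ s w) = w := by
  cases s with
  | inl g => exact act_inl_inv Φ g w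
  | inr h => exact act_inr_inv Φ h w

theorem invState_invState (s : G ⊕ H) : invState (invState s) = s := by
  cases s <;> simp [invState]

/-- The permutation of the set of words given by a state. -/
def statePerm (s : G ⊕ H) : Equiv.Perm (List X) where
  toFun := act Φ s
  invFun := act Φ (invState s)
  left_inv := act_invState Φ s
  right_inv w := by simpa only [invState_invState] using act_invState Φ (invState s) w

/-- The multispinal group: the automaton group generated by the states. -/
def multispinalGroup : Subgroup (Equiv.Perm (List X)) :=
  Subgroup.closure (Set.range (statePerm Φ))

theorem exists_section_of_mem {g : Equiv.Perm (List X)} (hg : g ∈ multispinalGroup Φ) :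
    g [] = [] ∧ ∀ x, ∃ y, ∃ h ∈ multispinalGroup Φ, ∀ w, g (x :: w) = y :: h w := by
  have key : ∀ s : G ⊕ H, statePerm Φ s [] = [] ∧
      ∀ x, ∃ y, ∃ h ∈ multispinalGroup Φ, ∀ w, statePerm Φ s (x :: w) = y :: h w := fun s =>
    ⟨rfl, fun x => ⟨out s x, statePerm Φ (sec Φ s x), Subgroup.subset_closure ⟨_, rfl⟩,
      fun _ => rfl⟩⟩
  have hinv : ∀ s : G ⊕ H, (statePerm Φ s)⁻¹ = statePerm Φ (invState s) := fun s => by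
    ext1 w
    rfl
  refine Subgroup.closure_induction'' (p := fun g _ => g [] = [] ∧
    ∀ x, ∃ y, ∃ h ∈ multispinalGroup Φ, ∀ w, g (x :: w) = y :: h w) ?_ ?_ ?_ ?_ hg
  · rintro _ ⟨s, rfl⟩
    exact key s
  · rintro _ ⟨s, rfl⟩
    rw [hinv]
    exact key _
  · exact ⟨rfl, fun x => ⟨x, 1, one_mem _, fun _ => rfl⟩⟩
  · rintro a b - - ⟨ha0, ha⟩ ⟨hb0, hb⟩
    refine ⟨by simp [hb0, ha0], fun x => ?_⟩
    obtain ⟨y, k, hk, e⟩ := hb x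
    obtain ⟨z, l, hl, f⟩ := ha y
    exact ⟨z, l * k, mul_mem hl hk, fun w => by simp [e, f]⟩

instance : SelfSimilarGroup (multispinalGroup Φ) X where
  faithful g h hgh := Subtype.ext (Equiv.ext hgh)
  length_smul := by
    suffices ∀ (w : List X) (g : Equiv.Perm (List X)), g ∈ multispinalGroup Φ →
        (g w).length = w.length from fun g w => this w g g.2
    intro w
    induction w with
    | nil =>
      intro g hg
      rw [(exists_section_of_mem Φ hg).1]
    | cons x w ih =>
      intro g hg
      obtain ⟨y, h, hh, e⟩ := (exists_section_of_mem Φ hg).2 x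
      simp [e, ih h hh]
  exists_section g x := by
    obtain ⟨y, h, hh, e⟩ := (exists_section_of_mem Φ g.2).2 x
    refine ⟨⟨h, hh⟩, fun w => ?_⟩
    change g.1 (x :: w) = g.1 [x] ++ h w
    rw [e, e, (exists_section_of_mem Φ hh).1]
    rfl

end Data

end Multispinal

/-!
Let `B` be the set of homomorphisms in (S3) and `J` the intersection of the kernels of the maps
`KG → KH` induced by the elements of `B`. The algebra acts on functions of self-maps of `X^*`,
modulo those vanishing on `w ↦ u ψ(w)` for all long words `u`, and this action shows that `KG`
embeds in it. An element of `J` is killed on the right by every word ending in a letter `y` with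
`Φ(y) ∈ Hom(G, H)`, hence lies in the proper ideal of all `a` such that every product `a b` is
killed by a power of `y`: if the algebra is simple, then `J = 0`. Conversely, let `J = 0`. A nonzero
element of an ideal, multiplied by a suitable word, becomes a nonzero combination of products `u g`
with `u` a word and `g ∈ G`. Some `λ ∈ B` does not kill it; as `λ(g)` is the section of `g` at a
word which is fixed by `G` and independent of `g`, and `H` acts freely, a further word turns it into
a nonzero combination of words, in which the coefficient of a shortest word can be isolated: the
ideal contains a nonzero scalar.

The vanishing of `J` does not change under extension of the field. If `J = 0`, then the product of
the kernels of the maps induced by `B` annihilates each irreducible representation, so one of these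
kernels does. If `char K` does not divide `|G|` and every irreducible representation factors through
the image of some `λ ∈ B`, then `J` annihilates all of them and vanishes by semisimplicity. If
`char K` divides all `|ker λ|`, then `J` contains the sum of the elements of `G`.
-/

namespace Multispinal

noncomputable section

theorem eq_of_append_replicate_isPrefix {X : Type*} {x y : X} (hxy : x ≠ y) {m : ℕ} {p q : List X}
    (hpq : p.length ≤ q.length) (hq : q.length ≤ m)
    (h : p ++ (List.replicate m x ++ [y]) <+: q ++ (List.replicate m x ++ [y])) : p = q := by
  obtain ⟨r, hr⟩ := h
  rw [List.append_assoc] at hr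
  obtain ⟨s, rfl⟩ : p <+: q := List.prefix_of_prefix_length_le ⟨_, hr⟩ ⟨_, rfl⟩ hpq
  rw [List.append_assoc, List.append_assoc, List.append_cancel_left_eq] at hr
  rw [List.length_append] at hq
  rcases Nat.eq_zero_or_pos s.length with h0 | h0
  · rw [List.length_eq_zero_iff.1 h0, List.append_nil]
  · have hy : (List.replicate m x ++ ([y] ++ r))[m]? = some y := by simp
    have hx : (s ++ (List.replicate m x ++ [y]))[m]? = some x := by
      rw [List.getElem?_append_right (by omega), List.getElem?_append_left (by simp; omega),
        List.getElem?_replicate, if_pos (by omega)]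
    rw [hr, hx] at hy
    exact absurd (Option.some.inj hy) hxy

/-! ### Words in the Nekrashevych algebra -/

section Algebra

variable (K : Type*) {𝔊 X : Type*} [Field K] [Fintype X] [Group 𝔊] [MulAction 𝔊 (List X)]
  [SelfSimilarGroup 𝔊 X]

variable (𝔊) in
/-- The letter `x` in the Nekrashevych algebra. -/
def letter (x : X) : NekrashevychAlgebra K 𝔊 X :=
  RingQuot.mkAlgHom K (NekrashevychRel K 𝔊 X) (FreeAlgebra.ι K (Gen.letter x))

variable (𝔊) in
/-- The adjoint `x^*` of a letter in the Nekrashevych algebra. -/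
def letterStar (x : X) : NekrashevychAlgebra K 𝔊 X :=
  RingQuot.mkAlgHom K (NekrashevychRel K 𝔊 X) (FreeAlgebra.ι K (Gen.letterStar x))

variable (X) in
/-- The elements of the self-similar group in the Nekrashevych algebra. -/
def elt : 𝔊 →* NekrashevychAlgebra K 𝔊 X where
  toFun g := RingQuot.mkAlgHom K (NekrashevychRel K 𝔊 X) (FreeAlgebra.ι K (Gen.elt g))
  map_one' := by
    rw [RingQuot.mkAlgHom_rel K (NekrashevychRel.one (K := K) (𝔊 := 𝔊) (X := X)), map_one]
  map_mul' g h := by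
    rw [← RingQuot.mkAlgHom_rel K (NekrashevychRel.mul (K := K) (X := X) g h), map_mul]

variable {K}

theorem elt_mul_letter {g h : 𝔊} {x y : X} (hs : ∀ w : List X, g • (x :: w) = y :: h • w) :
    elt K X g * letter K 𝔊 x = letter K 𝔊 y * elt K X h := by
  simpa only [map_mul] using!
    RingQuot.mkAlgHom_rel K (NekrashevychRel.smul_letter (K := K) g h x y hs)

theorem letterStar_mul_letter_self (x : X) : letterStar K 𝔊 x * letter K 𝔊 x = 1 := by
  simpa only [map_mul, map_one] using!
    RingQuot.mkAlgHom_rel K (NekrashevychRel.star_mul_self (K := K) (𝔊 := 𝔊) x)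

theorem letterStar_mul_letter_of_ne {x y : X} (hxy : x ≠ y) :
    letterStar K 𝔊 y * letter K 𝔊 x = 0 := by
  simpa only [map_mul, map_zero] using!
    RingQuot.mkAlgHom_rel K (NekrashevychRel.star_mul_of_ne (K := K) (𝔊 := 𝔊) x y hxy)

variable (K 𝔊 X) in
theorem sum_letter_mul_letterStar : ∑ x : X, letter K 𝔊 x * letterStar K 𝔊 x = 1 := by
  simpa only [map_sum, map_mul, map_one] using!
    RingQuot.mkAlgHom_rel K (NekrashevychRel.sum_mul_star (K := K) (𝔊 := 𝔊) (X := X))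

theorem exists_mul_letter_ne_zero {a : NekrashevychAlgebra K 𝔊 X} (ha : a ≠ 0) :
    ∃ x, a * letter K 𝔊 x ≠ 0 := by
  by_contra! h
  apply ha
  rw [← mul_one a, ← sum_letter_mul_letterStar, Finset.mul_sum]
  exact Finset.sum_eq_zero fun x _ => by rw [← mul_assoc, h, zero_mul]

theorem nekrashevych_induction {p : NekrashevychAlgebra K 𝔊 X → Prop}
    (algebraMap : ∀ c : K, p (algebraMap K _ c))
    (letter : ∀ x, p (letter K 𝔊 x)) (letterStar : ∀ x, p (letterStar K 𝔊 x))
    (elt : ∀ g, p (elt K X g)) (add : ∀ a b, p a → p b → p (a + b))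
    (mul : ∀ a b, p a → p b → p (a * b)) (a : NekrashevychAlgebra K 𝔊 X) : p a := by
  obtain ⟨a, rfl⟩ := RingQuot.mkAlgHom_surjective K (NekrashevychRel K 𝔊 X) a
  induction a using FreeAlgebra.induction with
  | grade0 c => simpa only [AlgHom.commutes] using algebraMap c
  | grade1 s =>
    cases s with
    | letter x => exact letter x
    | letterStar x => exact letterStar x
    | elt g => exact elt g
  | mul a b ha hb => simpa only [map_mul] using mul _ _ ha hb
  | add a b ha hb => simpa only [map_add] using add _ _ ha hb

variable (K 𝔊) in
/-- The product of the letters of a word. -/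
def word (u : List X) : NekrashevychAlgebra K 𝔊 X := (u.map (letter K 𝔊)).prod

variable (K 𝔊) in
/-- The adjoint of `word`, the product of the adjoints of the letters in reverse order. -/
def wordStar (u : List X) : NekrashevychAlgebra K 𝔊 X := (u.map (letterStar K 𝔊)).reverse.prod

@[simp] theorem word_nil : word K 𝔊 ([] : List X) = 1 := rfl

theorem word_cons (x : X) (u : List X) : word K 𝔊 (x :: u) = letter K 𝔊 x * word K 𝔊 u := by
  simp [word]

theorem word_append (u v : List X) : word K 𝔊 (u ++ v) = word K 𝔊 u * word K 𝔊 v := by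
  simp [word]

theorem word_append_singleton (u : List X) (x : X) :
    word K 𝔊 (u ++ [x]) = word K 𝔊 u * letter K 𝔊 x := by
  simp [word]

theorem word_replicate (n : ℕ) (x : X) : word K 𝔊 (List.replicate n x) = letter K 𝔊 x ^ n := by
  simp [word]

@[simp] theorem wordStar_nil : wordStar K 𝔊 ([] : List X) = 1 := rfl

theorem wordStar_cons (x : X) (u : List X) :
    wordStar K 𝔊 (x :: u) = wordStar K 𝔊 u * letterStar K 𝔊 x := by
  simp [wordStar]

theorem elt_mul_word {g h : 𝔊} {u v : List X} (hl : u.length = v.length)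
    (hs : ∀ w : List X, g • (u ++ w) = v ++ h • w) :
    elt K X g * word K 𝔊 u = word K 𝔊 v * elt K X h := by
  induction u generalizing g v with
  | nil =>
    obtain rfl := List.length_eq_zero_iff.1 hl.symm
    obtain rfl : g = h := SelfSimilarGroup.faithful g h hs
    simp
  | cons x u ih =>
    obtain ⟨y, v, rfl⟩ := List.exists_cons_of_length_eq_add_one hl.symm
    obtain ⟨k, hk⟩ := SelfSimilarGroup.exists_section g x
    obtain ⟨z, hz⟩ := List.length_eq_one_iff.1 (SelfSimilarGroup.length_smul g [x])
    rw [hz] at hk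
    have hsec (w : List X) : z = y ∧ k • (u ++ w) = v ++ h • w :=
      List.cons.inj ((hk _).symm.trans (hs w))
    obtain ⟨rfl, -⟩ := hsec []
    rw [word_cons, word_cons, ← mul_assoc, elt_mul_letter hk, mul_assoc,
      ih (Nat.succ_injective hl) fun w => (hsec w).2, mul_assoc]

theorem exists_mul_word_ne_zero {a : NekrashevychAlgebra K 𝔊 X} (ha : a ≠ 0) (n : ℕ) :
    ∃ v : List X, v.length = n ∧ a * word K 𝔊 v ≠ 0 := by
  induction n with
  | zero => exact ⟨[], rfl, by simpa using ha⟩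
  | succ n ih =>
    obtain ⟨v, hv, h⟩ := ih
    obtain ⟨x, hx⟩ := exists_mul_letter_ne_zero h
    exact ⟨v ++ [x], by simp [hv], by rwa [word_append_singleton, ← mul_assoc]⟩

theorem wordStar_mul_word_self (u : List X) : wordStar K 𝔊 u * word K 𝔊 u = 1 := by
  induction u with
  | nil => simp
  | cons x u ih =>
    rw [wordStar_cons, word_cons, mul_assoc, ← mul_assoc (letterStar K 𝔊 x),
      letterStar_mul_letter_self, one_mul, ih]

theorem wordStar_mul_word_of_not_isPrefix {u v : List X} (hl : u.length ≤ v.length)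
    (h : ¬ u <+: v) : wordStar K 𝔊 u * word K 𝔊 v = 0 := by
  induction u generalizing v with
  | nil => simp at h
  | cons x u ih =>
    obtain ⟨y, v, rfl⟩ := List.exists_cons_of_length_pos (Nat.zero_lt_of_lt hl)
    rw [wordStar_cons, word_cons, mul_assoc, ← mul_assoc (letterStar K 𝔊 x)]
    by_cases hxy : x = y
    · subst hxy
      rw [letterStar_mul_letter_self, one_mul, ih (by simpa using hl) (by simpa using h)]
    · rw [letterStar_mul_letter_of_ne (Ne.symm hxy), zero_mul, mul_zero]

/-! ### Ideals containing a combination of words -/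

-- For `t = x^m y` with `m` large, `(pt)^*` and `t` isolate the coefficient at a shortest word `p`.
theorem wordStar_mul_linearCombination_mul_word {x y : X} (hxy : x ≠ y) {F : List X →₀ K}
    {p : List X} (hp : p ∈ F.support) (hmin : ∀ q ∈ F.support, p.length ≤ q.length) {m : ℕ}
    (hm : ∀ q ∈ F.support, q.length ≤ m) :
    wordStar K 𝔊 (p ++ (List.replicate m x ++ [y])) * Finsupp.linearCombination K (word K 𝔊) F *
      word K 𝔊 (List.replicate m x ++ [y]) = algebraMap K _ (F p) := by
  rw [Finsupp.linearCombination_apply, Finsupp.sum, Finset.mul_sum, Finset.sum_mul,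
    Finset.sum_eq_single_of_mem p hp]
  · rw [mul_smul_comm, smul_mul_assoc, mul_assoc, ← word_append, wordStar_mul_word_self,
      Algebra.algebraMap_eq_smul_one]
  · intro q hq hqp
    rw [mul_smul_comm, smul_mul_assoc, mul_assoc, ← word_append,
      wordStar_mul_word_of_not_isPrefix (by simpa using hmin q hq) fun h =>
        hqp (eq_of_append_replicate_isPrefix hxy (hmin q hq) (hm q hq) h).symm, smul_zero]

theorem eq_top_of_linearCombination_word_mem {x y : X} (hxy : x ≠ y)
    (I : TwoSidedIdeal (NekrashevychAlgebra K 𝔊 X)) {F : List X →₀ K} (hF : F ≠ 0)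
    (hI : Finsupp.linearCombination K (word K 𝔊) F ∈ I) : I = ⊤ := by
  obtain ⟨p, hp, hmin⟩ := Finset.exists_min_image F.support List.length
    (Finsupp.support_nonempty_iff.2 hF)
  have hFp : algebraMap K (NekrashevychAlgebra K 𝔊 X) (F p) ∈ I := by
    rw [← wordStar_mul_linearCombination_mul_word hxy hp hmin fun q => Finset.le_sup]
    exact I.mul_mem_right _ _ (I.mul_mem_left _ _ hI)
  have h1 := I.mul_mem_left (algebraMap K _ (F p)⁻¹) _ hFp
  rw [← map_mul, inv_mul_cancel₀ (Finsupp.mem_support_iff.1 hp), map_one] at h1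
  exact (TwoSidedIdeal.one_mem_iff I).1 h1

end Algebra

/-! ### Linear independence of group elements -/

section Representation

variable (K : Type*) {𝔊 X : Type*} [Field K]

/-- The self-map `w ↦ x φ(w)` of the set of words. -/
def prepend (x : X) (φ : List X → List X) : List X → List X := fun w => x :: φ w

theorem prepend_injective (x : X) : Function.Injective (prepend x) := fun _ _ h =>
  funext fun w => (List.cons.inj (congrFun h w)).2

/-- The operator by which the letter `x` acts on functions of self-maps of `X^*`: transport along
`φ ↦ xφ`, with extension by zero. -/
def letterOp (x : X) : Module.End K ((List X → List X) → K) :=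
  Function.ExtendByZero.linearMap K (prepend x)

variable {K}

theorem letterOp_prepend (x : X) (F : (List X → List X) → K) (φ : List X → List X) :
    letterOp K x F (prepend x φ) = F φ :=
  (prepend_injective x).extend_apply F _ φ

theorem letterOp_of_forall_ne {x : X} (F : (List X → List X) → K) {φ : List X → List X}
    (h : ∀ ψ, prepend x ψ ≠ φ) : letterOp K x F φ = 0 :=
  Function.extend_apply' F _ φ fun ⟨ψ, hψ⟩ => h ψ hψ

theorem letterOp_prepend_of_ne {x y : X} (hxy : x ≠ y) (F : (List X → List X) → K)
    (φ : List X → List X) : letterOp K x F (prepend y φ) = 0 :=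
  letterOp_of_forall_ne F fun _ h => hxy (List.cons.inj (congrFun h [])).1

variable (K X) in
/-- The functions which vanish on all self-maps of `X^*` of the form `w ↦ u ψ(w)` with `u` long. -/
def eventuallyZero : Submodule K ((List X → List X) → K) where
  carrier := {F | ∃ n, ∀ u : List X, n ≤ u.length → ∀ ψ : List X → List X,
    F (fun w => u ++ ψ w) = 0}
  zero_mem' := ⟨0, fun _ _ _ => rfl⟩
  add_mem' := by
    rintro F F' ⟨n, hn⟩ ⟨n', hn'⟩
    refine ⟨max n n', fun u hu ψ => ?_⟩
    rw [Pi.add_apply, hn u (by omega), hn' u (by omega), add_zero]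
  smul_mem' := by
    rintro c F ⟨n, hn⟩
    exact ⟨n, fun u hu ψ => by rw [Pi.smul_apply, hn u hu, smul_zero]⟩

theorem sum_letterOp_sub_mem_eventuallyZero [Fintype X] (F : (List X → List X) → K) :
    ∑ x, letterOp K x (LinearMap.funLeft K K (prepend x) F) - F ∈ eventuallyZero K X := by
  refine ⟨1, fun u hu ψ => ?_⟩
  obtain ⟨y, u, rfl⟩ := List.exists_cons_of_length_pos hu
  change (∑ x, letterOp K x (LinearMap.funLeft K K (prepend x) F) - F)
    (prepend y fun w => u ++ ψ w) = 0
  rw [Pi.sub_apply, Finset.sum_apply, Finset.sum_eq_single_of_mem y (Finset.mem_univ y),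
    letterOp_prepend]
  · exact sub_self _
  · exact fun x _ hxy => letterOp_prepend_of_ne hxy _ _

variable [Group 𝔊] [MulAction 𝔊 (List X)]

theorem smul_prepend {g h : 𝔊} {x y : X} (hs : ∀ w : List X, g • (x :: w) = y :: h • w)
    (φ : List X → List X) : g • prepend x φ = prepend y (h • φ) := funext fun w => hs (φ w)

theorem letterOp_inv_smul {g h : 𝔊} {x y : X} (hs : ∀ w : List X, g • (x :: w) = y :: h • w)
    (F : (List X → List X) → K) (φ : List X → List X) :
    letterOp K x F (g⁻¹ • φ) = letterOp K y (fun ψ => F (h⁻¹ • ψ)) φ := by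
  by_cases hφ : ∃ ψ, prepend y ψ = φ
  · obtain ⟨ψ, rfl⟩ := hφ
    have hψ : g⁻¹ • prepend y ψ = prepend x (h⁻¹ • ψ) := by
      rw [inv_smul_eq_iff, smul_prepend hs, smul_inv_smul]
    rw [hψ, letterOp_prepend, letterOp_prepend]
  · push Not at hφ
    rw [letterOp_of_forall_ne _ hφ, letterOp_of_forall_ne]
    exact fun ψ hψ => hφ (h • ψ) (by rw [← smul_prepend hs, hψ, smul_inv_smul])

variable (K) in
/-- The operators by which the generators of the Nekrashevych algebra act on functions of self-maps
of `X^*`: `x` and `x^*` are transport along `φ ↦ xφ` and restriction along it, and `g` is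
translation. They satisfy all defining relations but `∑ x x^* = 1`. -/
def genOp : Gen 𝔊 X → Module.End K ((List X → List X) → K)
  | .letter x => letterOp K x
  | .letterStar x => LinearMap.funLeft K K (prepend x)
  | .elt g => LinearMap.funLeft K K (g⁻¹ • ·)

variable [SelfSimilarGroup 𝔊 X]

theorem exists_section_word (g : 𝔊) (u : List X) :
    ∃ v : List X, ∃ h : 𝔊, v.length = u.length ∧ ∀ w, g • (u ++ w) = v ++ h • w := by
  induction u generalizing g with
  | nil => exact ⟨[], g, rfl, fun _ => rfl⟩
  | cons x u ih =>
    obtain ⟨k, hk⟩ := SelfSimilarGroup.exists_section g x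
    obtain ⟨v, h, hv, hh⟩ := ih k
    exact ⟨g • [x] ++ v, h, by simp [hv, SelfSimilarGroup.length_smul, add_comm], fun w => by
      rw [List.cons_append, hk, hh, List.append_assoc]⟩

theorem genOp_mem_eventuallyZero (s : Gen 𝔊 X) :
    eventuallyZero K X ≤ (eventuallyZero K X).comap (genOp K s) := by
  rintro F ⟨n, hn⟩
  cases s with
  | letter x =>
    refine ⟨n + 1, fun u hu ψ => ?_⟩
    obtain ⟨y, u, rfl⟩ := List.exists_cons_of_length_pos (Nat.zero_lt_of_lt hu)
    change letterOp K x F (prepend y fun w => u ++ ψ w) = 0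
    by_cases hxy : x = y
    · subst hxy
      rw [letterOp_prepend, hn u (by simpa using hu)]
    · exact letterOp_prepend_of_ne hxy _ _
  | letterStar x => exact ⟨n, fun u hu ψ => hn (x :: u) (Nat.le_succ_of_le hu) ψ⟩
  | elt g =>
    refine ⟨n, fun u hu ψ => ?_⟩
    obtain ⟨v, h, hv, hh⟩ := exists_section_word g⁻¹ u
    have hg : (g⁻¹ • fun w => u ++ ψ w) = fun w => v ++ (h • ψ) w := funext fun w => hh (ψ w)
    change F (g⁻¹ • fun w => u ++ ψ w) = 0
    rw [hg, hn v (hv ▸ hu)]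

variable (K 𝔊 X) in
/-- The operators `genOp` on functions modulo those which are eventually zero. -/
def freeRep : FreeAlgebra K (Gen 𝔊 X) →ₐ[K]
    Module.End K (((List X → List X) → K) ⧸ eventuallyZero K X) :=
  FreeAlgebra.lift K fun s =>
    (eventuallyZero K X).mapQ (eventuallyZero K X) (genOp K s) (genOp_mem_eventuallyZero s)

theorem freeRep_ι (s : Gen 𝔊 X) (F : (List X → List X) → K) :
    freeRep K 𝔊 X (FreeAlgebra.ι K s) (Submodule.Quotient.mk F) =
      Submodule.Quotient.mk (genOp K s F) := by
  rw [freeRep, FreeAlgebra.lift_ι_apply, Submodule.mapQ_apply]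

theorem exists_apply_smul_append_eq_zero {F : (List X → List X) → K}
    (hF : F ∈ eventuallyZero K X) :
    ∃ n, ∀ (g : 𝔊) (u : List X), n ≤ u.length → F (g • fun w => u ++ w) = 0 := by
  obtain ⟨n, hn⟩ := hF
  refine ⟨n, fun g u hu => ?_⟩
  obtain ⟨v, h, hv, hh⟩ := exists_section_word g u
  have hg : (g • fun w => u ++ w) = fun w => v ++ (h • id) w := funext hh
  rw [hg, hn v (hv ▸ hu)]

theorem inv_smul_smul_append_mem_range_iff (g h : 𝔊) {p : ℕ → List X}
    (hp : ∀ n, (p n).length = n) (n : ℕ) :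
    (g⁻¹ • h • fun w => p n ++ w) ∈ Set.range (fun m w => p m ++ w) ↔
      ∀ w, g • (p n ++ w) = h • (p n ++ w) := by
  refine ⟨fun ⟨m, hm⟩ w => ?_, fun hgh => ⟨n, ?_⟩⟩
  · rw [eq_inv_smul_iff] at hm
    have hlen := congrArg List.length (congrFun hm [])
    simp only [Pi.smul_apply, SelfSimilarGroup.length_smul, List.append_nil, hp] at hlen
    exact hlen ▸ congrFun hm w
  · rw [eq_inv_smul_iff]
    exact funext hgh

variable [Fintype X]

theorem freeRep_eq_of_rel {a b : FreeAlgebra K (Gen 𝔊 X)} (h : NekrashevychRel K 𝔊 X a b) :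
    freeRep K 𝔊 X a = freeRep K 𝔊 X b := by
  ext F
  cases h <;>
    simp only [map_one, map_zero, map_mul, map_sum, LinearMap.comp_apply, Submodule.mkQ_apply,
      freeRep_ι, LinearMap.zero_apply, LinearMap.sum_apply, Module.End.one_apply,
      Module.End.mul_apply]
  case one =>
    congr 1
    ext φ
    change F ((1 : 𝔊)⁻¹ • φ) = F φ
    rw [inv_one, one_smul]
  case mul g h =>
    congr 1
    ext φ
    change F (h⁻¹ • g⁻¹ • φ) = F ((g * h)⁻¹ • φ)
    rw [mul_inv_rev, mul_smul]
  case smul_letter g h x y hs => exact congrArg _ (funext (letterOp_inv_smul hs F))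
  case letterStar_smul g h x y hs =>
    congr 1
    ext φ
    change F ((g⁻¹)⁻¹ • prepend x φ) = F (prepend y ((h⁻¹)⁻¹ • φ))
    rw [inv_inv, inv_inv, smul_prepend hs]
  case star_mul_self x => exact congrArg _ (funext (letterOp_prepend x F))
  case star_mul_of_ne x y hxy => exact congrArg _ (funext (letterOp_prepend_of_ne hxy F))
  case sum_mul_star =>
    simp only [← Submodule.mkQ_apply]
    rw [← map_sum, ← sub_eq_zero, ← map_sub]
    exact (Submodule.Quotient.mk_eq_zero _).2 (sum_letterOp_sub_mem_eventuallyZero F)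

variable (K 𝔊 X) in
/-- The representation of the Nekrashevych algebra on functions of self-maps of `X^*` modulo those
which are eventually zero. -/
def nekrashevychRep : NekrashevychAlgebra K 𝔊 X →ₐ[K]
    Module.End K (((List X → List X) → K) ⧸ eventuallyZero K X) :=
  RingQuot.liftAlgHom K ⟨freeRep K 𝔊 X, fun _ _ => freeRep_eq_of_rel⟩

theorem nekrashevychRep_elt (g : 𝔊) (F : (List X → List X) → K) :
    nekrashevychRep K 𝔊 X (elt K X g) (Submodule.Quotient.mk F) =
      Submodule.Quotient.mk fun φ => F (g⁻¹ • φ) := by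
  change nekrashevychRep K 𝔊 X (RingQuot.mkAlgHom K _ _) _ = _
  rw [nekrashevychRep, RingQuot.liftAlgHom_mkAlgHom_apply, freeRep_ι]
  rfl

variable (K) in
-- The group elements translate the class of the indicator function of `{w ↦ p n ++ w | n}` to
-- linearly independent classes.
theorem linearIndependent_elt {ι : Type*} (e : ι → 𝔊) (p : ℕ → List X)
    (hp : ∀ n, (p n).length = n)
    (he : ∀ n i j, (∀ w, e i • (p n ++ w) = e j • (p n ++ w)) → i = j) :
    LinearIndependent K fun i => elt K X (e i) := by
  let S : Set (List X → List X) := Set.range fun n w => p n ++ w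
  rw [linearIndependent_iff']
  intro s c hc j hj
  have hmem : ∑ i ∈ s, c i • (fun φ => S.indicator (fun _ => (1 : K)) ((e i)⁻¹ • φ)) ∈
      eventuallyZero K X := by
    rw [← Submodule.Quotient.mk_eq_zero, ← Submodule.mkQ_apply, map_sum]
    simpa only [map_sum, map_smul, map_zero, LinearMap.sum_apply, LinearMap.smul_apply,
      LinearMap.zero_apply, nekrashevychRep_elt, Submodule.mkQ_apply] using
      congrArg (fun a => nekrashevychRep K 𝔊 X a
        (Submodule.Quotient.mk (S.indicator fun _ => 1))) hc
  obtain ⟨n, hn⟩ := exists_apply_smul_append_eq_zero (𝔊 := 𝔊) hmem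
  have hS (i : ι) : ((e i)⁻¹ • e j • fun w => p n ++ w) ∈ S ↔ i = j :=
    (inv_smul_smul_append_mem_range_iff _ _ hp n).trans
      ⟨he n i j, fun hij w => by rw [hij]⟩
  have hsum := hn (e j) (p n) (hp n).ge
  rw [Finset.sum_apply, Finset.sum_eq_single_of_mem j hj] at hsum
  · rwa [Pi.smul_apply, Set.indicator_of_mem ((hS j).2 rfl), smul_eq_mul, mul_one] at hsum
  · intro i _ hij
    rw [Pi.smul_apply, Set.indicator_of_notMem (mt (hS i).1 hij), smul_zero]

end Representation

/-! ### Sections of products and spanning sets -/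

section Nucleus

variable {K 𝔊 X : Type*} [Field K] [Fintype X] [Group 𝔊] [MulAction 𝔊 (List X)]
  [SelfSimilarGroup 𝔊 X]

variable (K) in
/-- The span of the products `u g` with `u` a word of length at least `n` and `g ∈ T`. -/
def wordEltSpan (n : ℕ) (T : Set 𝔊) : Submodule K (NekrashevychAlgebra K 𝔊 X) :=
  Submodule.span K {a | ∃ u : List X, ∃ g ∈ T, n ≤ u.length ∧ word K 𝔊 u * elt K X g = a}

theorem word_mul_elt_mem_wordEltSpan {n : ℕ} {T : Set 𝔊} {u : List X} {g : 𝔊}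
    (hu : n ≤ u.length) (hg : g ∈ T) : word K 𝔊 u * elt K X g ∈ wordEltSpan K n T :=
  Submodule.subset_span ⟨u, g, hg, hu, rfl⟩

theorem wordEltSpan_mono {m n : ℕ} (h : m ≤ n) {T T' : Set 𝔊} (hT : T ⊆ T') :
    wordEltSpan (X := X) K n T ≤ wordEltSpan K m T' :=
  Submodule.span_mono fun _ ⟨u, g, hg, hu, e⟩ => ⟨u, g, hT hg, h.trans hu, e⟩

theorem mul_elt_mul_letter_mem_wordEltSpan {T T' : Set 𝔊} {k : 𝔊} {x : X}
    (hT : ∀ g ∈ T, ∃ y, ∃ h ∈ T', ∀ w : List X, (g * k) • (x :: w) = y :: h • w) {n : ℕ}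
    {a : NekrashevychAlgebra K 𝔊 X} (ha : a ∈ wordEltSpan K n T) :
    a * elt K X k * letter K 𝔊 x ∈ wordEltSpan K (n + 1) T' := by
  induction ha using Submodule.span_induction with
  | mem _ hmem =>
    obtain ⟨u, g, hg, hu, rfl⟩ := hmem
    obtain ⟨y, h, hh, hs⟩ := hT g hg
    rw [mul_assoc (word K 𝔊 u), ← map_mul, mul_assoc, elt_mul_letter hs, ← mul_assoc,
      ← word_append_singleton]
    exact word_mul_elt_mem_wordEltSpan (by simpa using hu) hh
  | zero => simp only [zero_mul, zero_mem]
  | add a b _ _ iha ihb => simpa only [add_mul] using add_mem iha ihb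
  | smul c a _ ih => simpa only [smul_mul_assoc] using Submodule.smul_mem _ c ih

theorem mul_letter_mem_wordEltSpan {T T' : Set 𝔊} {x : X}
    (hT : ∀ g ∈ T, ∃ y, ∃ h ∈ T', ∀ w : List X, g • (x :: w) = y :: h • w) {n : ℕ}
    {a : NekrashevychAlgebra K 𝔊 X} (ha : a ∈ wordEltSpan K n T) :
    a * letter K 𝔊 x ∈ wordEltSpan K (n + 1) T' := by
  simpa only [map_one, mul_one] using
    mul_elt_mul_letter_mem_wordEltSpan (k := 1) (by simpa only [mul_one] using hT) ha

theorem word_mem_wordEltSpan {n : ℕ} {T : Set 𝔊} (hT : 1 ∈ T) {u : List X} (hu : n ≤ u.length) :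
    word K 𝔊 u ∈ wordEltSpan K n T := by
  simpa only [map_one, mul_one] using word_mul_elt_mem_wordEltSpan (K := K) hu hT

/-- A set `T` which contains the identity, generates the self-similar group as a monoid and
contains all sections at letters of products of two of its elements. -/
structure IsSectionNucleus (X : Type*) [MulAction 𝔊 (List X)] (T : Set 𝔊) : Prop where
  one_mem : 1 ∈ T
  closure_eq_top : Submonoid.closure T = ⊤
  section_mul : ∀ g ∈ T, ∀ h ∈ T, ∀ x : X, ∃ y, ∃ k ∈ T, ∀ w, (g * h) • (x :: w) = y :: k • w

/-- The products of `a` with long words are combinations of products `u g` with `u` a long word and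
`g ∈ T`. -/
def IsEventuallyReduced (T : Set 𝔊) (a : NekrashevychAlgebra K 𝔊 X) : Prop :=
  ∃ n, ∀ m, ∀ v : List X, n + m ≤ v.length → a * word K 𝔊 v ∈ wordEltSpan K m T

namespace IsEventuallyReduced

variable {T : Set 𝔊} {a b : NekrashevychAlgebra K 𝔊 X}

theorem add (ha : IsEventuallyReduced T a) (hb : IsEventuallyReduced T b) :
    IsEventuallyReduced T (a + b) := by
  obtain ⟨n, hn⟩ := ha
  obtain ⟨n', hn'⟩ := hb
  refine ⟨max n n', fun m v hv => ?_⟩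
  rw [add_mul]
  exact add_mem (hn m v (by omega)) (hn' m v (by omega))

theorem algebraMap (hT : 1 ∈ T) (c : K) :
    IsEventuallyReduced T (algebraMap K (NekrashevychAlgebra K 𝔊 X) c) := by
  refine ⟨0, fun m v hv => ?_⟩
  rw [← Algebra.smul_def]
  exact Submodule.smul_mem _ c (word_mem_wordEltSpan hT (by omega))

theorem letter (hT : 1 ∈ T) (x : X) : IsEventuallyReduced T (letter K 𝔊 x) := by
  refine ⟨0, fun m v hv => ?_⟩
  rw [← word_cons]
  exact word_mem_wordEltSpan hT (by rw [List.length_cons]; omega)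

theorem letterStar (hT : 1 ∈ T) (x : X) : IsEventuallyReduced T (letterStar K 𝔊 x) := by
  refine ⟨1, fun m v hv => ?_⟩
  obtain ⟨y, v, rfl⟩ := List.exists_cons_of_length_pos (by omega : 0 < v.length)
  rw [List.length_cons] at hv
  rw [word_cons, ← mul_assoc]
  by_cases hxy : y = x
  · rw [hxy, letterStar_mul_letter_self, one_mul]
    exact word_mem_wordEltSpan hT (by omega)
  · rw [letterStar_mul_letter_of_ne hxy, zero_mul]
    exact zero_mem _

theorem mul (hT : IsSectionNucleus X T) (ha : IsEventuallyReduced T a)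
    (hb : IsEventuallyReduced T b) : IsEventuallyReduced T (a * b) := by
  obtain ⟨n, hn⟩ := ha
  obtain ⟨n', hn'⟩ := hb
  refine ⟨n' + n + 1, fun m v hv => ?_⟩
  obtain rfl | ⟨v, x, rfl⟩ := v.eq_nil_or_concat'
  · simp at hv
  rw [List.length_append, List.length_singleton] at hv
  have hbv : b * word K 𝔊 v ∈ wordEltSpan K (n + m) T := hn' _ v (by omega)
  rw [word_append_singleton, mul_assoc a, ← mul_assoc b, ← mul_assoc]
  generalize b * word K 𝔊 v = c at hbv
  induction hbv using Submodule.span_induction with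
  | mem _ hmem =>
    obtain ⟨u, g, hg, hu, rfl⟩ := hmem
    rw [← mul_assoc a]
    exact wordEltSpan_mono (Nat.le_succ m) subset_rfl
      (mul_elt_mul_letter_mem_wordEltSpan (fun k hk => hT.section_mul k hk g hg x) (hn m u hu))
  | zero => simp only [mul_zero, zero_mul, zero_mem]
  | add c d _ _ ihc ihd => simpa only [mul_add, add_mul] using add_mem ihc ihd
  | smul r c _ ih =>
    simpa only [mul_smul_comm, smul_mul_assoc] using Submodule.smul_mem _ r ih

theorem elt (hT : IsSectionNucleus X T) (g : 𝔊) : IsEventuallyReduced T (elt K X g) := by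
  have hg : g ∈ Submonoid.closure T := hT.closure_eq_top ▸ Submonoid.mem_top g
  induction hg using Submonoid.closure_induction with
  | mem g hg =>
    suffices h : ∀ v : List X, Multispinal.elt K X g * word K 𝔊 v ∈ wordEltSpan K v.length T from
      ⟨0, fun m v hv => wordEltSpan_mono (by omega) subset_rfl (h v)⟩
    intro v
    induction v using List.reverseRecOn with
    | nil => simpa using word_mul_elt_mem_wordEltSpan (K := K) (u := ([] : List X)) le_rfl hg
    | append_singleton v x ih =>
      rw [word_append_singleton, ← mul_assoc, List.length_append]
      refine mul_letter_mem_wordEltSpan (fun k hk => ?_) ih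
      simpa only [mul_one] using hT.section_mul k hk 1 hT.one_mem x
  | one => simpa only [map_one] using algebraMap (K := K) (X := X) hT.one_mem 1
  | mul g h _ _ ihg ihh => simpa only [map_mul] using mul hT ihg ihh

end IsEventuallyReduced

theorem IsSectionNucleus.isEventuallyReduced {T : Set 𝔊} (hT : IsSectionNucleus X T)
    (a : NekrashevychAlgebra K 𝔊 X) : IsEventuallyReduced T a := by
  induction a using nekrashevych_induction with
  | algebraMap c => exact .algebraMap hT.one_mem c
  | letter x => exact .letter hT.one_mem x
  | letterStar x => exact .letterStar hT.one_mem x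
  | elt g => exact .elt hT g
  | add a b ha hb => exact ha.add hb
  | mul a b ha hb => exact ha.mul hT hb

end Nucleus

/-! ### Eventual annihilators -/

section EventualAnnihilator

variable {R : Type*} [Ring R]

/-- The two-sided ideal of the elements `a` such that, for every `b`, the product `a b` is
annihilated from the right by a power of `y`. -/
def eventualAnnihilator (y : R) : TwoSidedIdeal R :=
  .mk' {a | ∀ b, ∃ n : ℕ, a * b * y ^ n = 0} (fun b => ⟨0, by simp⟩)
    (by
      intro a a' ha ha' b
      obtain ⟨n, hn⟩ := ha b
      obtain ⟨n', hn'⟩ := ha' b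
      refine ⟨n + n', ?_⟩
      rw [add_mul, add_mul, pow_add, ← mul_assoc, hn, zero_mul, zero_add, ← pow_add, add_comm,
        pow_add, ← mul_assoc, hn', zero_mul])
    (fun ha b => (ha b).imp fun n hn => by rw [neg_mul, neg_mul, hn, neg_zero])
    (fun {c a} ha b => (ha b).imp fun n hn => by rw [mul_assoc c, mul_assoc c, hn, mul_zero])
    (fun {a c} ha b => (ha (c * b)).imp fun n hn => by rw [mul_assoc a, hn])

theorem mem_eventualAnnihilator {a y : R} :
    a ∈ eventualAnnihilator y ↔ ∀ b, ∃ n : ℕ, a * b * y ^ n = 0 :=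
  TwoSidedIdeal.mem_mk' ..

theorem eventualAnnihilator_eq_bot [IsSimpleRing R] {y y' : R} (h : y' * y = 1) :
    eventualAnnihilator y = ⊥ := by
  refine (eq_bot_or_eq_top _).resolve_right fun htop => ?_
  have h1 : (1 : R) ∈ eventualAnnihilator y := htop ▸ TwoSidedIdeal.mem_top R
  obtain ⟨n, hn⟩ := mem_eventualAnnihilator.1 h1 1
  rw [mul_one, one_mul] at hn
  exact one_ne_zero ((pow_mul_pow_eq_one n h).symm.trans (by rw [hn, mul_zero]))

end EventualAnnihilator

/-! ### Joint kernels on group algebras -/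

section JointKer

theorem mapDomain_map {R S M N : Type*} [Semiring R] [Semiring S] (θ : R →+ S) (φ : M → N)
    (f : MonoidAlgebra R M) :
    MonoidAlgebra.mapDomain φ (MonoidAlgebra.map θ f) =
      MonoidAlgebra.map θ (MonoidAlgebra.mapDomain φ f) :=
  MonoidAlgebra.coeff_injective
    (Finsupp.mapDomain_mapRange φ f.coeff θ (map_zero θ) (map_add θ))

theorem curry_mapDomain_prodMap {ι M N R : Type*} [AddCommMonoid R] (φ : M → N) (f : ι × M →₀ R)
    (i : ι) : (Finsupp.mapDomain (Prod.map id φ) f).curry i = Finsupp.mapDomain φ (f.curry i) := by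
  classical
  induction f using Finsupp.induction_linear with
  | zero => simp [← Finsupp.coe_curryAddEquiv]
  | add f g hf hg =>
    simp only [← Finsupp.coe_curryAddEquiv, Finsupp.mapDomain_add, map_add,
      Finsupp.add_apply] at hf hg ⊢
    rw [hf, hg]
  | single p c =>
    obtain ⟨j, m⟩ := p
    by_cases hij : j = i
    · subst hij
      simp
    · simp [hij]

variable (K : Type*) {L G H : Type*} [Field K] [Field L] [Group G] [Group H]

/-- The intersection of the kernels of the homomorphisms `KG → KH` induced by the elements of a set
of homomorphisms `G → H`. -/
def jointKer (B : Set (G →* H)) : Ideal (MonoidAlgebra K G) :=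
  ⨅ lam ∈ B, RingHom.ker (MonoidAlgebra.mapDomainAlgHom K K lam :
    MonoidAlgebra K G →ₐ[K] MonoidAlgebra K H)

variable {K} {B : Set (G →* H)}

theorem mem_jointKer {f : MonoidAlgebra K G} :
    f ∈ jointKer K B ↔ ∀ lam ∈ B, MonoidAlgebra.mapDomain lam f = 0 := by
  simp [jointKer, Submodule.mem_iInf, RingHom.mem_ker]

theorem mapDomain_mem_jointKer {G' : Type*} [Group G'] {B' : Set (G' →* H)} {φ : G →* G'}
    (hφ : ∀ lam ∈ B', lam.comp φ ∈ B) {f : MonoidAlgebra K G} (hf : f ∈ jointKer K B) :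
    MonoidAlgebra.mapDomain φ f ∈ jointKer K B' :=
  mem_jointKer.2 fun lam hlam =>
    (congrArg MonoidAlgebra.ofCoeff Finsupp.mapDomain_comp).symm.trans
      (mem_jointKer.1 hf _ (hφ lam hlam))

theorem map_mem_jointKer (θ : K →+ L) {f : MonoidAlgebra K G} (hf : f ∈ jointKer K B) :
    MonoidAlgebra.map θ f ∈ jointKer L B :=
  mem_jointKer.2 fun lam hlam => by
    rw [mapDomain_map, mem_jointKer.1 hf lam hlam, MonoidAlgebra.map_zero]

-- Nonzero coefficients in `L` are detected by `K`-linear functionals, which preserve joint kernels.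
theorem jointKer_eq_bot_iff_of_algebra [Algebra K L] : jointKer L B = ⊥ ↔ jointKer K B = ⊥ := by
  simp only [Submodule.eq_bot_iff]
  refine ⟨fun h f hf => ?_, fun h f hf => ?_⟩
  · have hf0 := h _ (map_mem_jointKer (algebraMap K L : K →+ L) hf)
    rw [← MonoidAlgebra.map_zero (algebraMap K L : K →+ L)] at hf0
    exact MonoidAlgebra.map_injective _ (algebraMap K L).injective hf0
  · ext g
    refine (Module.forall_dual_apply_eq_zero_iff K (f.coeff g)).1 fun θ => ?_
    simpa using congrArg (fun k => k.coeff g) (h _ (map_mem_jointKer (θ : L →+ K) hf))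

theorem exists_mapDomain_prodMap_ne_zero (h : jointKer K B = ⊥) {ι : Type*} {f : ι × G →₀ K}
    (hf : f ≠ 0) : ∃ lam ∈ B, Finsupp.mapDomain (Prod.map id lam) f ≠ 0 := by
  contrapose! hf
  refine Finsupp.curryAddEquiv.map_eq_zero_iff.1 (Finsupp.ext fun i => ?_)
  have hi : MonoidAlgebra.ofCoeff (f.curry i) ∈ jointKer K B := mem_jointKer.2 fun lam hlam =>
    MonoidAlgebra.coeff_injective <| by
      change Finsupp.mapDomain lam (f.curry i) = 0
      rw [← curry_mapDomain_prodMap, hf lam hlam, ← Finsupp.coe_curryAddEquiv, map_zero,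
        Finsupp.zero_apply]
  rw [h, Submodule.mem_bot] at hi
  exact congrArg MonoidAlgebra.coeff hi

end JointKer

/-! ### The states of a multispinal group -/

section States

variable {G H X : Type*} [Group G] [Group H] {Φ : X → MulAut G ⊕ (G →* H)}

theorem comp_mem_homSet {lam : G →* H} (hlam : lam ∈ homSet Φ) {x : X} {α : MulAut G}
    (hx : Φ x = .inl α) : lam.comp (α : G ≃* G).toMonoidHom ∈ homSet Φ := by
  obtain ⟨y, μ, β, hβ, hy, rfl⟩ := hlam
  exact ⟨y, μ, β * α, mul_mem hβ (Subgroup.subset_closure ⟨x, hx⟩), hy, rfl⟩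

theorem mem_homSet {x : X} {μ : G →* H} (hx : Φ x = .inr μ) : μ ∈ homSet Φ :=
  ⟨x, μ, 1, one_mem _, hx, rfl⟩

instance finite_mulAut [Finite G] : Finite (MulAut G) :=
  Finite.of_injective _ (DFunLike.coe_injective (F := G ≃* G))

theorem finite_homSet [Finite G] [Finite X] : (homSet Φ).Finite := by
  have hhom : (Sum.inr ⁻¹' Set.range Φ).Finite :=
    (Set.finite_range Φ).preimage Sum.inr_injective.injOn
  refine (hhom.image2 (fun μ (α : MulAut G) => μ.comp (α : G ≃* G).toMonoidHom)
    Set.finite_univ).subset ?_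
  rintro _ ⟨x, μ, α, -, hx, rfl⟩
  exact ⟨μ, ⟨x, hx⟩, α, Set.mem_univ α, rfl⟩

theorem exists_card_ker_eq_of_mem_homSet {lam : G →* H} (hlam : lam ∈ homSet Φ) :
    ∃ x μ, Φ x = .inr μ ∧ Nat.card lam.ker = Nat.card μ.ker := by
  obtain ⟨x, μ, α, -, hx, rfl⟩ := hlam
  exact ⟨x, μ, hx, Nat.card_congr ((α : G ≃* G).toEquiv.subtypeEquiv fun _ => Iff.rfl)⟩

variable [MulAction H X]

variable (Φ) in
theorem act_inr_mul (h k : H) (w : List X) :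
    act Φ (.inr (h * k)) w = act Φ (.inr h) (act Φ (.inr k) w) := by
  cases w with
  | nil => rfl
  | cons x w => simp [act, out, sec, act_inr_one, mul_smul]

variable (Φ) in
theorem act_inl_mul (g k : G) (w : List X) :
    act Φ (.inl (g * k)) w = act Φ (.inl g) (act Φ (.inl k) w) := by
  induction w generalizing g k with
  | nil => rfl
  | cons x w ih => rcases hx : Φ x with α | μ <;> simp [act, out, sec, hx, ih, act_inr_mul]

variable (Φ) in
/-- A state as an element of the multispinal group. -/
def state (s : G ⊕ H) : multispinalGroup Φ :=
  ⟨statePerm Φ s, Subgroup.subset_closure ⟨s, rfl⟩⟩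

variable (Φ) in
theorem state_smul_cons (s : G ⊕ H) (x : X) (w : List X) :
    state Φ s • (x :: w) = out s x :: (state Φ (sec Φ s x) • w) := rfl

theorem inv_state (s : G ⊕ H) : (state Φ s)⁻¹ = state Φ (invState s) :=
  Subtype.ext (Equiv.ext fun _ => rfl)

variable (Φ) in
/-- The homomorphism from `G` to the multispinal group. -/
def inlHom : G →* multispinalGroup Φ :=
  MonoidHom.mk' (fun g => state Φ (.inl g)) fun g k =>
    SelfSimilarGroup.faithful _ _ (act_inl_mul Φ g k)

variable (Φ) in
/-- The homomorphism from `H` to the multispinal group. -/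
def inrHom : H →* multispinalGroup Φ :=
  MonoidHom.mk' (fun h => state Φ (.inr h)) fun h k =>
    SelfSimilarGroup.faithful _ _ (act_inr_mul Φ h k)

variable (Φ) in
theorem inrHom_smul_cons (h : H) (x : X) (w : List X) :
    inrHom Φ h • (x :: w) = (h • x) :: (1 : multispinalGroup Φ) • w := by
  rw [← map_one (inrHom Φ)]
  rfl

theorem inlHom_smul_cons_of_inl {x : X} {α : MulAut G} (hx : Φ x = .inl α) (g : G) (w : List X) :
    inlHom Φ g • (x :: w) = x :: inlHom Φ (α g) • w := by
  refine (state_smul_cons Φ (.inl g) x w).trans ?_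
  simp only [out, sec, hx]
  rfl

theorem inlHom_smul_cons_of_inr {x : X} {μ : G →* H} (hx : Φ x = .inr μ) (g : G) (w : List X) :
    inlHom Φ g • (x :: w) = x :: inrHom Φ (μ g) • w := by
  refine (state_smul_cons Φ (.inl g) x w).trans ?_
  simp only [out, sec, hx]
  rfl

theorem exists_state_mul_sec_eq (s t : G ⊕ H) (x : X) :
    ∃ r, state Φ (sec Φ s (out t x)) * state Φ (sec Φ t x) = state Φ r := by
  have hone : state Φ (.inr 1) = 1 := map_one (inrHom Φ)
  rcases s with g | h
  · rcases t with k | h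
    · rcases hx : Φ x with α | μ <;> simp only [sec, out, hx]
      · exact ⟨.inl (α g * α k), (map_mul (inlHom Φ) (α g) (α k)).symm⟩
      · exact ⟨.inr (μ g * μ k), (map_mul (inrHom Φ) (μ g) (μ k)).symm⟩
    · exact ⟨_, (congrArg _ hone).trans (mul_one _)⟩
  · exact ⟨_, (congrArg (· * _) hone).trans (one_mul _)⟩

theorem isSectionNucleus_range_state : IsSectionNucleus X (Set.range (state Φ)) where
  one_mem := ⟨.inr 1, map_one (inrHom Φ)⟩
  closure_eq_top := by
    have hpre : Set.range (state Φ) = (↑) ⁻¹' Set.range (statePerm Φ) := by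
      ext g
      simp only [Set.mem_range, Set.mem_preimage, Subtype.ext_iff]
      rfl
    have hinv : (Set.range (state Φ))⁻¹ ⊆ Set.range (state Φ) := fun g ⟨s, hs⟩ =>
      ⟨invState s, by rw [← inv_state, hs, inv_inv]⟩
    rw [← Set.union_eq_self_of_subset_right hinv, ← Subgroup.closure_toSubmonoid, hpre]
    exact congrArg _ Subgroup.closure_closure_coe_preimage
  section_mul := by
    rintro _ ⟨s, rfl⟩ _ ⟨t, rfl⟩ x
    obtain ⟨r, hr⟩ := exists_state_mul_sec_eq s t x
    refine ⟨out s (out t x), _, ⟨r, rfl⟩, fun w => ?_⟩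
    rw [mul_smul, state_smul_cons, state_smul_cons, ← hr, mul_smul]

theorem exists_section_hom_letter {y : X} {μ : G →* H} (hy : Φ y = .inr μ) :
    ∀ g ∈ Set.range (state Φ), ∃ z, ∃ h ∈ Set.range (inrHom Φ),
      ∀ w : List X, g • (y :: w) = z :: h • w := by
  rintro _ ⟨g | h, rfl⟩
  · exact ⟨y, _, ⟨μ g, rfl⟩, inlHom_smul_cons_of_inr hy g⟩
  · exact ⟨h • y, _, ⟨1, map_one _⟩, inrHom_smul_cons Φ h y⟩

theorem exists_section_aut_letter {x : X} {α : MulAut G} (hx : Φ x = .inl α) :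
    ∀ g ∈ Set.range (state Φ), ∃ z, ∃ h ∈ Set.range (inlHom Φ),
      ∀ w : List X, g • (x :: w) = z :: h • w := by
  rintro _ ⟨g | h, rfl⟩
  · exact ⟨x, _, ⟨α g, rfl⟩, inlHom_smul_cons_of_inl hx g⟩
  · exact ⟨h • x, _, ⟨1, map_one _⟩, inrHom_smul_cons Φ h x⟩

variable (Φ) in
theorem exists_section_inrHom (x : X) :
    ∀ g ∈ Set.range (inrHom Φ), ∃ z, ∃ h ∈ ({1} : Set (multispinalGroup Φ)),
      ∀ w : List X, g • (x :: w) = z :: h • w := by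
  rintro _ ⟨h, rfl⟩
  exact ⟨h • x, 1, rfl, inrHom_smul_cons Φ h x⟩

theorem closure_toSubmonoid_le_of_isOfFinOrder {M : Type*} [Group M] {S : Set M}
    (hS : ∀ a ∈ S, IsOfFinOrder a) {N : Submonoid M} (hN : S ⊆ N) :
    (Subgroup.closure S).toSubmonoid ≤ N := by
  rw [Subgroup.closure_toSubmonoid, Submonoid.closure_le]
  refine Set.union_subset hN fun a ha => ?_
  have hpow : a ∈ Submonoid.powers a⁻¹ := by
    rw [(hS _ ha).mem_powers_iff_mem_zpowers, Subgroup.zpowers_inv]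
    exact Subgroup.mem_zpowers a
  exact Submonoid.powers_le.2 (hN ha) hpow

variable (Φ) in
/-- The automorphisms `α` of `G` such that, for some word `u` fixed by `G`, the section of every
`g ∈ G` at `u` is `α(g)`. -/
def sectionAut : Submonoid (MulAut G) where
  carrier := {α | ∃ u : List X, ∀ (g : G) (w : List X),
    inlHom Φ g • (u ++ w) = u ++ inlHom Φ (α g) • w}
  one_mem' := ⟨[], fun _ _ => rfl⟩
  mul_mem' := by
    rintro α β ⟨u, hu⟩ ⟨v, hv⟩
    exact ⟨v ++ u, fun g w => by
      rw [List.append_assoc, hv, hu, List.append_assoc, MulAut.mul_apply]⟩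

theorem mem_sectionAut {x : X} {α : MulAut G} (hx : Φ x = .inl α) : α ∈ sectionAut Φ :=
  ⟨[x], inlHom_smul_cons_of_inl hx⟩

theorem exists_word_of_mem_homSet (hfin : ∀ x α, Φ x = .inl α → IsOfFinOrder α) {lam : G →* H}
    (hlam : lam ∈ homSet Φ) :
    ∃ u : List X, ∀ (g : G) (w : List X),
      inlHom Φ g • (u ++ w) = u ++ inrHom Φ (lam g) • w := by
  obtain ⟨x, μ, α, hα, hx, rfl⟩ := hlam
  obtain ⟨u, hu⟩ : α ∈ sectionAut Φ :=
    closure_toSubmonoid_le_of_isOfFinOrder (S := {α | ∃ x, Φ x = .inl α})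
      (fun α ⟨x, hx⟩ => hfin x α hx) (fun _ ⟨_, hx⟩ => mem_sectionAut hx) hα
  exact ⟨u ++ [x], fun g w => by
    rw [List.append_assoc, hu, List.singleton_append, inlHom_smul_cons_of_inr hx,
      List.append_assoc]
    rfl⟩

theorem inlHom_injective (hfree : ∀ (h : H) (x : X), h • x = x → h = 1)
    (hfin : ∀ x α, Φ x = .inl α → IsOfFinOrder α) (hΦ : IsMultispinal Φ) :
    Function.Injective (inlHom Φ) := by
  rw [injective_iff_map_eq_one]
  intro g hg
  rw [← Subgroup.mem_bot, ← hΦ.iInf_ker]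
  simp only [Subgroup.mem_iInf, MonoidHom.mem_ker]
  intro lam hlam
  obtain ⟨u, hu⟩ := exists_word_of_mem_homSet hfin hlam
  obtain ⟨x, -⟩ := hΦ.exists_aut
  have hx := hu g [x]
  rw [hg, one_smul, List.append_cancel_left_eq, inrHom_smul_cons] at hx
  exact hfree _ x (List.cons.inj hx).1.symm

theorem inlHom_smul_replicate_append {x : X} {α : MulAut G} (hx : Φ x = .inl α) (n : ℕ) (g : G)
    (w : List X) : inlHom Φ g • (List.replicate n x ++ w) =
      List.replicate n x ++ inlHom Φ ((α ^ n) g) • w := by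
  induction n generalizing g with
  | zero => rfl
  | succ n ih =>
    rw [List.replicate_succ, List.cons_append, inlHom_smul_cons_of_inl hx, ih, pow_succ]
    rfl

theorem append_append_smul_injective (hfree : ∀ (h : H) (x : X), h • x = x → h = 1)
    (u : List X) (x : X) :
    Function.Injective fun p : List X × H => p.1 ++ (u ++ [p.2 • x]) := by
  rintro ⟨v, h⟩ ⟨v', h'⟩ e
  obtain ⟨rfl, e⟩ := List.append_inj' e (by simp)
  have hx : h • x = h' • x := by simpa using e
  rw [← inv_mul_eq_one.1 (hfree (h⁻¹ * h') x (by rw [mul_smul, ← hx, inv_smul_smul]))]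

end States

/-! ### The Nekrashevych algebra of a multispinal group -/

section Multispinal

variable {G H X : Type*} [Group G] [Group H] [Fintype X] [MulAction H X]
  {Φ : X → MulAut G ⊕ (G →* H)} {K : Type*} [Field K]

variable (Φ K) in
/-- The homomorphism from `KG` to the Nekrashevych algebra. -/
def inlAlgHom : MonoidAlgebra K G →ₐ[K] NekrashevychAlgebra K (multispinalGroup Φ) X :=
  MonoidAlgebra.lift K _ G ((elt K X).comp (inlHom Φ))

variable (Φ K) in
/-- The homomorphism from `KH` to the Nekrashevych algebra. -/
def inrAlgHom : MonoidAlgebra K H →ₐ[K] NekrashevychAlgebra K (multispinalGroup Φ) X :=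
  MonoidAlgebra.lift K _ H ((elt K X).comp (inrHom Φ))

theorem inlAlgHom_mul_letter_of_inl {x : X} {α : MulAut G} (hx : Φ x = .inl α)
    (f : MonoidAlgebra K G) :
    inlAlgHom Φ K f * letter K _ x = letter K _ x *
      inlAlgHom Φ K (MonoidAlgebra.mapDomainAlgHom K K (α : G ≃* G).toMonoidHom f) := by
  induction f using MonoidAlgebra.induction_linear with
  | zero => simp
  | add f g hf hg => simp only [map_add, add_mul, mul_add, hf, hg]
  | single g a => simp [inlAlgHom, elt_mul_letter (K := K) (inlHom_smul_cons_of_inl hx g)]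

theorem inlAlgHom_mul_letter_of_inr {x : X} {μ : G →* H} (hx : Φ x = .inr μ)
    (f : MonoidAlgebra K G) :
    inlAlgHom Φ K f * letter K _ x =
      letter K _ x * inrAlgHom Φ K (MonoidAlgebra.mapDomainAlgHom K K μ f) := by
  induction f using MonoidAlgebra.induction_linear with
  | zero => simp
  | add f g hf hg => simp only [map_add, add_mul, mul_add, hf, hg]
  | single g a =>
    simp [inlAlgHom, inrAlgHom, elt_mul_letter (K := K) (inlHom_smul_cons_of_inr hx g)]

theorem inlAlgHom_injective (hfree : ∀ (h : H) (x : X), h • x = x → h = 1)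
    (hfin : ∀ x α, Φ x = .inl α → IsOfFinOrder α) (hΦ : IsMultispinal Φ) :
    Function.Injective (inlAlgHom Φ K) := by
  obtain ⟨x, α, hx⟩ := hΦ.exists_aut
  have hli : LinearIndependent K fun g => elt K X (inlHom Φ g) := by
    refine linearIndependent_elt K _ (fun n => List.replicate n x) (by simp) fun n g k hgk => ?_
    simp only [inlHom_smul_replicate_append hx, List.append_cancel_left_eq] at hgk
    exact (α ^ n).injective (inlHom_injective hfree hfin hΦ (SelfSimilarGroup.faithful _ _ hgk))
  rw [injective_iff_map_eq_zero]
  intro f hf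
  refine MonoidAlgebra.coeff_injective (linearIndependent_iff.1 hli f.coeff ?_)
  rwa [inlAlgHom, MonoidAlgebra.lift_apply] at hf

theorem inlAlgHom_mul_word_mul_letter_eq_zero {y : X} {μ : G →* H} (hy : Φ y = .inr μ)
    {f : MonoidAlgebra K G} (hf : f ∈ jointKer K (homSet Φ)) (u : List X) :
    inlAlgHom Φ K f * (word K _ u * letter K _ y) = 0 := by
  have hom {x : X} {μ : G →* H} (hx : Φ x = .inr μ) {f : MonoidAlgebra K G}
      (hf : f ∈ jointKer K (homSet Φ)) : inlAlgHom Φ K f * letter K _ x = 0 := by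
    rw [inlAlgHom_mul_letter_of_inr hx, MonoidAlgebra.mapDomainAlgHom_apply,
      mem_jointKer.1 hf μ (mem_homSet hx), map_zero, mul_zero]
  induction u generalizing f with
  | nil => rw [word_nil, one_mul, hom hy hf]
  | cons x u ih =>
    rw [word_cons, mul_assoc, ← mul_assoc]
    rcases hx : Φ x with α | ν
    · have hα := mapDomain_mem_jointKer (fun lam hlam => comp_mem_homSet hlam hx) hf
      rw [inlAlgHom_mul_letter_of_inl hx, mul_assoc, MonoidAlgebra.mapDomainAlgHom_apply, ih hα,
        mul_zero]
    · rw [hom hx hf, zero_mul]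

theorem inlAlgHom_mul_mul_letter_eq_zero {y : X} {μ : G →* H} (hy : Φ y = .inr μ)
    {f : MonoidAlgebra K G} (hf : f ∈ jointKer K (homSet Φ))
    {c : NekrashevychAlgebra K (multispinalGroup Φ) X} (hc : c ∈ wordEltSpan K 0 {1}) :
    inlAlgHom Φ K f * (c * letter K _ y) = 0 := by
  induction hc using Submodule.span_induction with
  | mem _ hmem =>
    obtain ⟨u, g, rfl, -, rfl⟩ := hmem
    rw [map_one, mul_one, inlAlgHom_mul_word_mul_letter_eq_zero hy hf]
  | zero => rw [zero_mul, mul_zero]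
  | add c d _ _ hc hd => rw [add_mul, mul_add, hc, hd, add_zero]
  | smul r c _ hc => rw [smul_mul_assoc, mul_smul_comm, hc, smul_zero]

theorem inlAlgHom_mem_eventualAnnihilator {y : X} {μ : G →* H} (hy : Φ y = .inr μ)
    {f : MonoidAlgebra K G} (hf : f ∈ jointKer K (homSet Φ)) :
    inlAlgHom Φ K f ∈ eventualAnnihilator (letter K (multispinalGroup Φ) y) := by
  refine mem_eventualAnnihilator.2 fun b => ?_
  obtain ⟨n, hn⟩ := isSectionNucleus_range_state.isEventuallyReduced b
  have h₀ : b * letter K _ y ^ n ∈ wordEltSpan K 0 (Set.range (state Φ)) := by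
    rw [← word_replicate]
    exact hn 0 _ (by simp)
  have h₁ := mul_letter_mem_wordEltSpan (exists_section_hom_letter hy) h₀
  have h₂ := mul_letter_mem_wordEltSpan (exists_section_inrHom Φ y) h₁
  refine ⟨n + 3, ?_⟩
  rw [← inlAlgHom_mul_mul_letter_eq_zero hy hf (wordEltSpan_mono (Nat.zero_le _) subset_rfl h₂)]
  simp only [pow_succ, mul_assoc]

theorem jointKer_eq_bot_of_isSimpleRing (hfree : ∀ (h : H) (x : X), h • x = x → h = 1)
    (hfin : ∀ x α, Φ x = .inl α → IsOfFinOrder α) (hΦ : IsMultispinal Φ)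
    [IsSimpleRing (NekrashevychAlgebra K (multispinalGroup Φ) X)] :
    jointKer K (homSet Φ) = ⊥ := by
  obtain ⟨y, μ, hy⟩ := hΦ.exists_hom
  refine (Submodule.eq_bot_iff _).2 fun f hf => ?_
  have h := inlAlgHom_mem_eventualAnnihilator hy hf
  rw [eventualAnnihilator_eq_bot (letterStar_mul_letter_self y), TwoSidedIdeal.mem_bot] at h
  exact (map_eq_zero_iff _ (inlAlgHom_injective hfree hfin hΦ)).1 h

theorem exists_mul_word_mem_wordEltSpan_range_inlHom
    {a : NekrashevychAlgebra K (multispinalGroup Φ) X} (ha : a ≠ 0) :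
    ∃ v : List X, a * word K _ v ≠ 0 ∧
      a * word K _ v ∈ wordEltSpan K 0 (Set.range (inlHom Φ)) := by
  obtain ⟨n, hn⟩ := isSectionNucleus_range_state.isEventuallyReduced a
  obtain ⟨v, hv, hav⟩ := exists_mul_word_ne_zero ha n
  have h₀ := hn 0 v hv.ge
  obtain ⟨x, hx₀⟩ := exists_mul_letter_ne_zero hav
  rcases hx : Φ x with α | μ
  · refine ⟨v ++ [x], ?_⟩
    rw [word_append_singleton, ← mul_assoc]
    exact ⟨hx₀, wordEltSpan_mono (Nat.zero_le _) subset_rfl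
      (mul_letter_mem_wordEltSpan (exists_section_aut_letter hx) h₀)⟩
  · obtain ⟨z, hz⟩ := exists_mul_letter_ne_zero hx₀
    have h₁ := mul_letter_mem_wordEltSpan (exists_section_hom_letter hx) h₀
    have hone : {1} ⊆ Set.range (inlHom Φ) := Set.singleton_subset_iff.2 ⟨1, map_one _⟩
    refine ⟨v ++ [x] ++ [z], ?_⟩
    rw [word_append_singleton, word_append_singleton, ← mul_assoc, ← mul_assoc]
    exact ⟨hz, wordEltSpan_mono (Nat.zero_le _) hone
      (mul_letter_mem_wordEltSpan (exists_section_inrHom Φ z) h₁)⟩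

theorem exists_linearCombination_eq_of_mem_wordEltSpan
    {a : NekrashevychAlgebra K (multispinalGroup Φ) X}
    (ha : a ∈ wordEltSpan K 0 (Set.range (inlHom Φ))) :
    ∃ f : List X × G →₀ K,
      Finsupp.linearCombination K (fun p => word K _ p.1 * elt K X (inlHom Φ p.2)) f = a := by
  rw [← Set.mem_range, ← LinearMap.coe_range, SetLike.mem_coe, Finsupp.range_linearCombination]
  refine Submodule.span_mono (fun b hb => ?_) ha
  obtain ⟨u, _, ⟨g, rfl⟩, -, rfl⟩ := hb
  exact ⟨(u, g), rfl⟩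

theorem elt_inlHom_mul_word_append_singleton {lam : G →* H} {u : List X}
    (hu : ∀ (g : G) (w : List X), inlHom Φ g • (u ++ w) = u ++ inrHom Φ (lam g) • w)
    (g : G) (x : X) :
    elt K X (inlHom Φ g) * word K _ (u ++ [x]) = word K _ (u ++ [lam g • x]) := by
  rw [← mul_one (word K _ (u ++ [lam g • x])), ← map_one (elt K X)]
  refine elt_mul_word (by simp) fun w => ?_
  rw [List.append_assoc, hu, List.singleton_append, inrHom_smul_cons, List.append_assoc,
    List.singleton_append]

theorem linearCombination_mul_word_append_singleton {lam : G →* H} {u : List X}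
    (hu : ∀ (g : G) (w : List X), inlHom Φ g • (u ++ w) = u ++ inrHom Φ (lam g) • w)
    (x : X) (f : List X × G →₀ K) :
    Finsupp.linearCombination K (fun p => word K _ p.1 * elt K X (inlHom Φ p.2)) f *
        word K _ (u ++ [x]) =
      Finsupp.linearCombination K (word K (multispinalGroup Φ))
        ((f.mapDomain (Prod.map id lam)).mapDomain fun p => p.1 ++ (u ++ [p.2 • x])) := by
  rw [← Finsupp.mapDomain_comp, Finsupp.linearCombination_mapDomain,
    Finsupp.linearCombination_apply, Finsupp.linearCombination_apply, Finsupp.sum, Finset.sum_mul]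
  refine Finset.sum_congr rfl fun p _ => ?_
  rw [smul_mul_assoc, mul_assoc, elt_inlHom_mul_word_append_singleton hu, ← word_append]
  rfl

theorem isSimpleRing_of_jointKer_eq_bot (hfree : ∀ (h : H) (x : X), h • x = x → h = 1)
    (hfin : ∀ x α, Φ x = .inl α → IsOfFinOrder α) (hΦ : IsMultispinal Φ)
    (hker : jointKer K (homSet Φ) = ⊥) :
    IsSimpleRing (NekrashevychAlgebra K (multispinalGroup Φ) X) := by
  obtain ⟨x, α, hx⟩ := hΦ.exists_aut
  obtain ⟨y, μ, hy⟩ := hΦ.exists_hom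
  have hxy : x ≠ y := by
    rintro rfl
    simp [hx] at hy
  have := (inlAlgHom_injective (K := K) hfree hfin hΦ).nontrivial
  refine ⟨⟨fun I => or_iff_not_imp_left.2 fun hI => ?_⟩⟩
  obtain ⟨a, haI, ha⟩ : ∃ a ∈ I, a ≠ 0 := by
    by_contra! h
    exact hI (le_bot_iff.1 fun a ha => (TwoSidedIdeal.mem_bot _).2 (h a ha))
  obtain ⟨v, hv, hav⟩ := exists_mul_word_mem_wordEltSpan_range_inlHom ha
  obtain ⟨f, hf⟩ := exists_linearCombination_eq_of_mem_wordEltSpan hav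
  have hf₀ : f ≠ 0 := by
    rintro rfl
    exact hv (hf.symm.trans (map_zero _))
  obtain ⟨lam, hlam, hlam₀⟩ := exists_mapDomain_prodMap_ne_zero hker hf₀
  obtain ⟨u, hu⟩ := exists_word_of_mem_homSet hfin hlam
  have hinj := Finsupp.mapDomain_injective (M := K) (append_append_smul_injective hfree u x)
  refine eq_top_of_linearCombination_word_mem hxy I
    (Finsupp.mapDomain_zero (M := K) ▸ hinj.ne hlam₀) ?_
  rw [← linearCombination_mul_word_append_singleton hu, hf]
  exact I.mul_mem_right _ _ (I.mul_mem_right _ _ haI)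

theorem isSimpleRing_iff_jointKer_eq_bot (hfree : ∀ (h : H) (x : X), h • x = x → h = 1)
    (hfin : ∀ x α, Φ x = .inl α → IsOfFinOrder α) (hΦ : IsMultispinal Φ) :
    IsSimpleRing (NekrashevychAlgebra K (multispinalGroup Φ) X) ↔ jointKer K (homSet Φ) = ⊥ :=
  ⟨fun _ => jointKer_eq_bot_of_isSimpleRing hfree hfin hΦ,
    isSimpleRing_of_jointKer_eq_bot hfree hfin hΦ⟩

end Multispinal

/-! ### Irreducible representations -/

section Irreducible

theorem le_annihilator_or_le_annihilator_of_mul_le {R M : Type*} [Ring R] [AddCommGroup M]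
    [Module R M] [IsSimpleModule R M] {I J : Ideal R} (h : I * J ≤ Module.annihilator R M) :
    I ≤ Module.annihilator R M ∨ J ≤ Module.annihilator R M := by
  rw [← Submodule.annihilator_top, Submodule.le_annihilator_iff] at h ⊢
  rcases eq_bot_or_eq_top (J • (⊤ : Submodule R M)) with hJ | hJ
  · exact .inr (Submodule.le_annihilator_iff.2 hJ)
  · rw [← smul_eq_mul, Submodule.smul_assoc, hJ] at h
    exact .inl h

theorem exists_le_annihilator_of_iInf_le {R M ι : Type*} [Ring R] [AddCommGroup M]
    [Module R M] [IsSimpleModule R M] {I : ι → Ideal R} [∀ i, (I i).IsTwoSided] {s : Set ι}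
    (hs : s.Finite) (h : ⨅ i ∈ s, I i ≤ Module.annihilator R M) :
    ∃ i ∈ s, I i ≤ Module.annihilator R M := by
  induction s, hs using Set.Finite.induction_on with
  | empty =>
    have := IsSimpleModule.nontrivial R M
    rw [iInf_emptyset, top_le_iff, Module.annihilator_eq_top_iff] at h
    exact absurd h (not_subsingleton M)
  | @insert i s _ _ ih =>
    rw [iInf_insert] at h
    rcases le_annihilator_or_le_annihilator_of_mul_le (Ideal.mul_le_inf.trans h) with hi | hi
    · exact ⟨i, Set.mem_insert i s, hi⟩
    · obtain ⟨j, hj, hj'⟩ := ih hi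
      exact ⟨j, Set.mem_insert_of_mem i hj, hj'⟩

variable {L G H V : Type*} [Field L] [Group G] [Group H] [AddCommGroup V] [Module L V]

theorem asAlgebraHom_eq_zero_of_ker_le (ρ : Representation L G V) {lam : G →* H}
    (hker : lam.ker ≤ MonoidHom.ker ρ) {f : MonoidAlgebra L G}
    (hf : MonoidAlgebra.mapDomain lam f = 0) : ρ.asAlgebraHom f = 0 := by
  have hfac : Function.FactorsThrough ρ lam := fun g k hgk => by
    have h : g⁻¹ * k ∈ MonoidHom.ker ρ :=
      hker (by rw [MonoidHom.mem_ker, map_mul, map_inv, hgk, inv_mul_cancel])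
    rw [← mul_inv_cancel_left g k, map_mul, MonoidHom.mem_ker.1 h, mul_one]
  calc ρ.asAlgebraHom f = Finsupp.linearCombination L (Function.extend lam ρ 0 ∘ lam) f.coeff := by
        rw [hfac.extend_comp, Representation.asAlgebraHom_def, MonoidAlgebra.lift_apply]
        rfl
    _ = Finsupp.linearCombination L (Function.extend lam ρ 0)
          (MonoidAlgebra.mapDomain lam f).coeff := by
        rw [← Finsupp.linearCombination_mapDomain]
        rfl
    _ = 0 := by rw [hf, MonoidAlgebra.coeff_zero, map_zero]

theorem ker_le_ker_of_ker_mapDomainAlgHom_le (ρ : Representation L G V) {lam : G →* H}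
    (h : RingHom.ker (MonoidAlgebra.mapDomainAlgHom L L lam :
      MonoidAlgebra L G →ₐ[L] MonoidAlgebra L H) ≤ RingHom.ker ρ.asAlgebraHom) :
    lam.ker ≤ MonoidHom.ker ρ := by
  intro n hn
  have hmem : MonoidAlgebra.single n (1 : L) - 1 ∈ RingHom.ker
      (MonoidAlgebra.mapDomainAlgHom L L lam : MonoidAlgebra L G →ₐ[L] MonoidAlgebra L H) := by
    rw [RingHom.mem_ker, map_sub, map_one, sub_eq_zero, MonoidAlgebra.mapDomainAlgHom_apply,
      MonoidAlgebra.mapDomain_single, MonoidHom.mem_ker.1 hn, MonoidAlgebra.one_def]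
  simpa [RingHom.mem_ker, sub_eq_zero] using h hmem

theorem exists_ker_le_of_jointKer_eq_bot {B : Set (G →* H)} (hB : B.Finite)
    (h : jointKer L B = ⊥) (ρ : Representation L G V) (hρ : ρ.IsIrreducible) :
    ∃ lam ∈ B, lam.ker ≤ MonoidHom.ker ρ := by
  have hle : jointKer L B ≤ Module.annihilator (MonoidAlgebra L G) ρ.asModule := h ▸ bot_le
  obtain ⟨lam, hlam, hann⟩ := exists_le_annihilator_of_iInf_le hB hle
  refine ⟨lam, hlam, ker_le_ker_of_ker_mapDomainAlgHom_le ρ fun f hf => ?_⟩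
  ext v
  exact Module.mem_annihilator.1 (hann hf) (ρ.asModuleEquiv.symm v)

theorem smul_eq_zero_of_forall_asAlgebraHom_eq_zero {L M : Type u} [Field L]
    {f : MonoidAlgebra L G}
    (h : ∀ (V : Type u) [AddCommGroup V] [Module L V] (ρ : Representation L G V),
      ρ.IsIrreducible → ρ.asAlgebraHom f = 0)
    [AddCommGroup M] [Module (MonoidAlgebra L G) M] [IsSimpleModule (MonoidAlgebra L G) M] (m : M) :
    f • m = 0 := by
  have hf : (Representation.ofModule (k := L) (G := G) M).asAlgebraHom f = 0 :=
    @h _ _ (RestrictScalars.module L (MonoidAlgebra L G) M) _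
      ((Representation.isSimpleModule_iff_irreducible_ofModule M).1 inferInstance)
  have hm := Representation.ofModule_asAlgebraHom_apply_apply M f
    ((RestrictScalars.addEquiv L (MonoidAlgebra L G) M).symm m)
  rw [hf, AddEquiv.apply_symm_apply] at hm
  exact (RestrictScalars.addEquiv L (MonoidAlgebra L G) M).symm.injective
    (hm.symm.trans (map_zero _).symm)

theorem eq_zero_of_forall_asAlgebraHom_eq_zero {L : Type u} [Field L]
    [IsSemisimpleRing (MonoidAlgebra L G)] [Small.{u} (MonoidAlgebra L G)] {f : MonoidAlgebra L G}
    (h : ∀ (V : Type u) [AddCommGroup V] [Module L V] (ρ : Representation L G V),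
      ρ.IsIrreducible → ρ.asAlgebraHom f = 0) : f = 0 := by
  rw [← Submodule.mem_bot (MonoidAlgebra L G), ← IsSemisimpleRing.jacobson_eq_bot,
    Ring.jacobson, Module.jacobson, Submodule.mem_sInf]
  intro m hm
  have : IsSimpleModule (MonoidAlgebra L G) (MonoidAlgebra L G ⧸ m) :=
    isSimpleModule_iff_isCoatom.2 hm
  have : Small.{u} (MonoidAlgebra L G ⧸ m) :=
    small_of_surjective (Submodule.Quotient.mk_surjective m)
  let e := Shrink.linearEquiv.{u} (MonoidAlgebra L G) (MonoidAlgebra L G ⧸ m)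
  have : IsSimpleModule (MonoidAlgebra L G) (Shrink.{u} (MonoidAlgebra L G ⧸ m)) :=
    IsSimpleModule.congr e
  have hf := smul_eq_zero_of_forall_asAlgebraHom_eq_zero h (e.symm (Submodule.Quotient.mk 1))
  rwa [← map_smul, ← Submodule.Quotient.mk_smul, smul_eq_mul, mul_one,
    LinearEquiv.map_eq_zero_iff, Submodule.Quotient.mk_eq_zero] at hf

theorem jointKer_eq_bot_of_forall_exists_ker_le {L : Type u} [Field L]
    [NeZero (Nat.card G : L)] {B : Set (G →* H)}
    (h : ∀ (V : Type u) [AddCommGroup V] [Module L V] (ρ : Representation L G V),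
      ρ.IsIrreducible → ∃ lam ∈ B, lam.ker ≤ MonoidHom.ker ρ) : jointKer L B = ⊥ := by
  have : Finite G := Nat.finite_of_card_ne_zero fun h0 =>
    NeZero.ne (Nat.card G : L) (by simp [h0])
  have : Small.{u} (MonoidAlgebra L G) :=
    small_of_injective (DFunLike.coe_injective.comp MonoidAlgebra.coeff_injective)
  refine (Submodule.eq_bot_iff _).2 fun f hf =>
    eq_zero_of_forall_asAlgebraHom_eq_zero fun V _ _ ρ hρ => ?_
  obtain ⟨lam, hlam, hker⟩ := h V ρ hρ
  exact asAlgebraHom_eq_zero_of_ker_le ρ hker (mem_jointKer.1 hf lam hlam)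

theorem mapDomain_sum_single_eq_zero {K : Type*} [Field K] [Fintype G] {lam : G →* H}
    (h : (Nat.card lam.ker : K) = 0) :
    MonoidAlgebra.mapDomain lam (∑ g, MonoidAlgebra.single g (1 : K)) = 0 := by
  classical
  ext k
  have hsum : (MonoidAlgebra.mapDomain lam (∑ g, MonoidAlgebra.single g (1 : K))).coeff k =
      ((Finset.univ.filter fun g => lam g = k).card : K) := by
    simp [Finsupp.mapDomain_finsetSum, Finsupp.single_apply]
  rw [hsum, MonoidAlgebra.coeff_zero, Finsupp.zero_apply]
  by_cases hk : k ∈ Set.range lam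
  · rw [MonoidHom.card_fiber_eq_of_mem_range lam hk ⟨1, map_one lam⟩, ← h,
      Nat.card_eq_fintype_card, Fintype.card_subtype]
    simp only [MonoidHom.mem_ker]
  · rw [Finset.filter_eq_empty_iff.2 fun g _ e => hk ⟨g, e⟩, Finset.card_empty, Nat.cast_zero]

theorem jointKer_ne_bot_of_card_ker_eq_zero {K : Type*} [Field K] [Finite G] {B : Set (G →* H)}
    (h : ∀ lam ∈ B, (Nat.card lam.ker : K) = 0) : jointKer K B ≠ ⊥ := by
  have := Fintype.ofFinite G
  intro hbot
  have hmem : ∑ g : G, MonoidAlgebra.single g (1 : K) ∈ jointKer K B :=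
    mem_jointKer.2 fun lam hlam => mapDomain_sum_single_eq_zero (h lam hlam)
  rw [hbot, Submodule.mem_bot] at hmem
  simpa [Finsupp.single_apply] using congrArg (fun f => f.coeff 1) hmem

end Irreducible

end

end Multispinal

theorem theoremt_general {G H X : Type*} [Group G] [Group H] [Fintype X]
    [MulAction H X] (hfree : ∀ (h : H) (x : X), h • x = x → h = 1)
    (Φ : X → MulAut G ⊕ (G →* H)) (hΦ : Multispinal.IsMultispinal Φ)
    (hfin : ∀ x α, Φ x = Sum.inl α → IsOfFinOrder α) (K : Type u) [Field K] :
    (IsSimpleRing (Multispinal.NekrashevychAlgebra K (Multispinal.multispinalGroup Φ) X) ↔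
      ⨅ lam ∈ Multispinal.homSet Φ,
        RingHom.ker (MonoidAlgebra.mapDomainAlgHom K K lam :
          MonoidAlgebra K G →ₐ[K] MonoidAlgebra K H) = ⊥) ∧
    (Finite G →
      IsSimpleRing (Multispinal.NekrashevychAlgebra K (Multispinal.multispinalGroup Φ) X) →
        ∀ (V : Type u) [AddCommGroup V] [Module (AlgebraicClosure K) V]
          (ρ : Representation (AlgebraicClosure K) G V), ρ.IsIrreducible →
          ∃ lam ∈ Multispinal.homSet Φ, MonoidHom.ker lam ≤ MonoidHom.ker ρ) ∧
    (¬ ringChar K ∣ Nat.card G →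
      (∀ (V : Type u) [AddCommGroup V] [Module (AlgebraicClosure K) V]
        (ρ : Representation (AlgebraicClosure K) G V), ρ.IsIrreducible →
        ∃ lam ∈ Multispinal.homSet Φ, MonoidHom.ker lam ≤ MonoidHom.ker ρ) →
      IsSimpleRing (Multispinal.NekrashevychAlgebra K (Multispinal.multispinalGroup Φ) X)) ∧
    (Finite G → (∀ (x : X) (lam : G →* H), Φ x = Sum.inr lam →
        ringChar K ∣ Nat.card (MonoidHom.ker lam)) →
      ¬ IsSimpleRing (Multispinal.NekrashevychAlgebra K (Multispinal.multispinalGroup Φ) X)) := by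
  have hiff := Multispinal.isSimpleRing_iff_jointKer_eq_bot (K := K) hfree hfin hΦ
  refine ⟨hiff, fun _ hsimple V _ _ ρ hρ => ?_, fun hchar hrep => ?_, fun _ hdvd hsimple => ?_⟩
  · exact Multispinal.exists_ker_le_of_jointKer_eq_bot Multispinal.finite_homSet
      (Multispinal.jointKer_eq_bot_iff_of_algebra.2 (hiff.1 hsimple)) ρ hρ
  · have : NeZero (Nat.card G : AlgebraicClosure K) := ⟨fun h => hchar (ringChar.dvd
      ((algebraMap K (AlgebraicClosure K)).injective (by rw [map_natCast, h, map_zero])))⟩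
    exact hiff.2 (Multispinal.jointKer_eq_bot_iff_of_algebra.1
      (Multispinal.jointKer_eq_bot_of_forall_exists_ker_le hrep))
  · refine Multispinal.jointKer_ne_bot_of_card_ker_eq_zero (fun lam hlam => ?_) (hiff.1 hsimple)
    obtain ⟨x, μ, hx, hcard⟩ := Multispinal.exists_card_ker_eq_of_mem_homSet hlam
    rw [hcard, (ringChar.spec K _).2 (hdvd x μ hx)]

theorem theoremt {G H X : Type*} [Group G] [Finite G] [Group H] [Finite H] [Fintype X]
    [MulAction H X] (hfree : ∀ (h : H) (x : X), h • x = x → h = 1)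
    (Φ : X → MulAut G ⊕ (G →* H)) (hΦ : Multispinal.IsMultispinal Φ)
    (K : Type u) [Field K] :
    (IsSimpleRing (Multispinal.NekrashevychAlgebra K (Multispinal.multispinalGroup Φ) X) ↔
      ⨅ lam ∈ Multispinal.homSet Φ,
        RingHom.ker (MonoidAlgebra.mapDomainAlgHom K K lam :
          MonoidAlgebra K G →ₐ[K] MonoidAlgebra K H) = ⊥) ∧
    (¬ ringChar K ∣ Nat.card G →
      (IsSimpleRing (Multispinal.NekrashevychAlgebra K (Multispinal.multispinalGroup Φ) X) ↔
        ∀ (V : Type u) [AddCommGroup V] [Module (AlgebraicClosure K) V]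
          (ρ : Representation (AlgebraicClosure K) G V), ρ.IsIrreducible →
          ∃ lam ∈ Multispinal.homSet Φ, MonoidHom.ker lam ≤ MonoidHom.ker ρ)) ∧
    ((∀ (x : X) (lam : G →* H), Φ x = Sum.inr lam →
        ringChar K ∣ Nat.card (MonoidHom.ker lam)) →
      ¬ IsSimpleRing (Multispinal.NekrashevychAlgebra K (Multispinal.multispinalGroup Φ) X)) := by
  obtain ⟨h1, h2, h3, h4⟩ := theoremt_general hfree Φ hΦ (fun _ _ _ => isOfFinOrder_of_finite _) K
  exact ⟨h1, fun hchar => ⟨h2 inferInstance, h3 hchar⟩, h4 inferInstance⟩
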